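/- Let $\mathbb{N}$ denote the set of positive integers, and order $\mathbb{N}\times\mathbb{N}$ by $(i,m)\leqslant(j,n)$ if and only if $i\le j$ and $m\le n$. Let $\mathscr{PO}_\infty(\mathbb{N}^2_{\leqslant})$ be the monoid, under composition of partial maps ($x(\alpha\beta)=(x\alpha)\beta$ for $x\in\operatorname{dom}(\alpha\beta)=\{y\in\operatorname{dom}\alpha : y\alpha\in\operatorname{dom}\beta\}$), of all injective partial maps $\alpha\colon\mathbb{N}\times\mathbb{N}\rightharpoonup\mathbb{N}\times\mathbb{N}$ that are monotone (that is, $x\leqslant y$ implies $(x)\alpha\leqslant(y)\alpha$ for all $x,y\in\operatorname{dom}\alpha$) and for which the complements of $\operatorname{dom}\alpha$ and $\operatorname{ran}\alpha$ in $\mathbb{N}\times\mathbb{N}$ are finite. Put $\mathsf{H}^1=\{(j,1) : j\in\mathbb{N}\}$ and let $$\mathscr{PO}^{\,+}_\infty(\mathbb{N}^2_{\leqslant})=\{\alpha\in\mathscr{PO}_\infty(\mathbb{N}^2_{\leqslant}) : (\mathsf{H}^1\cap\operatorname{dom}\alpha)\alpha\subseteq\mathsf{H}^1\},$$ which is a submonoid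 of $\mathscr{PO}_\infty(\mathbb{N}^2_{\leqslant})$. Then every countable (infinite or finite) commutative monoid $M$ is a homomorphic image of $\mathscr{PO}^{\,+}_\infty(\mathbb{N}^2_{\leqslant})$: there is a surjective homomorphism $\mathscr{PO}^{\,+}_\infty(\mathbb{N}^2_{\leqslant})\to M$. -/

import Mathlib

/-- The symmetric inverse monoid over `X`: all partial one-to-one transformations of `X`. -/
def SymInvMonoid (X : Type*) : Type _ := PEquiv X X

namespace SymInvMonoid

variable {X : Type*}

/-- `α.Maps x y` says that `x` lies in the domain of `α` and that `α` sends `x` to `y`. -/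
def Maps (α : SymInvMonoid X) (x y : X) : Prop := PEquiv.toFun α x = some y

/-- The domain of a partial map. -/
def dom (α : SymInvMonoid X) : Set X := {x | ∃ y, α.Maps x y}

/-- The range of a partial map. -/
def ran (α : SymInvMonoid X) : Set X := {y | ∃ x, α.Maps x y}

/-- The product is composition of partial maps written on the right:
`α * β` is first `α`, then `β`, defined wherever this makes sense. -/
instance : Monoid (SymInvMonoid X) where
  mul α β := PEquiv.trans α β
  mul_assoc α β γ := PEquiv.trans_assoc α β γ
  one := PEquiv.refl X
  one_mul α := PEquiv.refl_trans α
  mul_one α := PEquiv.trans_refl α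

theorem maps_one {x y : X} : (1 : SymInvMonoid X).Maps x y ↔ x = y :=
  Option.some_inj

theorem maps_mul {α β : SymInvMonoid X} {x z : X} :
    (α * β).Maps x z ↔ ∃ y, α.Maps x y ∧ β.Maps y z :=
  Option.bind_eq_some_iff

theorem Maps.left_inj {α : SymInvMonoid X} {x x' y : X} (h : α.Maps x y) (h' : α.Maps x' y) :
    x = x' :=
  PEquiv.inj α h h'

theorem Maps.right_unique {α : SymInvMonoid X} {x y y' : X} (h : α.Maps x y)
    (h' : α.Maps x y') : y = y' :=
  Option.some_inj.1 (h.symm.trans h')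

/-- A partial selfmap of a poset is monotone if it preserves `≤` on its domain. -/
def IsMonotone [Preorder X] (α : SymInvMonoid X) : Prop :=
  ∀ ⦃x y x' y' : X⦄, α.Maps x x' → α.Maps y y' → x ≤ y → x' ≤ y'

theorem finite_compl_dom_mul {α β : SymInvMonoid X} (hα : α.domᶜ.Finite) (hβ : β.domᶜ.Finite) :
    (α * β).domᶜ.Finite := by
  have h : (α * β).domᶜ ⊆ α.domᶜ ∪ {x | ∃ y ∈ β.domᶜ, α.Maps x y} := by
    intro x hx
    by_cases hxα : x ∈ α.dom
    · obtain ⟨y, hy⟩ := hxα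
      refine Or.inr ⟨y, ?_, hy⟩
      rintro ⟨z, hz⟩
      exact hx ⟨z, maps_mul.2 ⟨y, hy, hz⟩⟩
    · exact Or.inl hxα
  refine (hα.union ?_).subset h
  have h2 : {x | ∃ y ∈ β.domᶜ, α.Maps x y} = ⋃ y ∈ β.domᶜ, {x | α.Maps x y} := by
    ext x; simp
  rw [h2]
  exact hβ.biUnion fun y _ => Set.Subsingleton.finite fun a ha b hb => Maps.left_inj ha hb

theorem finite_compl_ran_mul {α β : SymInvMonoid X} (hα : α.ranᶜ.Finite) (hβ : β.ranᶜ.Finite) :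
    (α * β).ranᶜ.Finite := by
  have h : (α * β).ranᶜ ⊆ β.ranᶜ ∪ {z | ∃ y ∈ α.ranᶜ, β.Maps y z} := by
    intro z hz
    by_cases hzβ : z ∈ β.ran
    · obtain ⟨y, hy⟩ := hzβ
      refine Or.inr ⟨y, ?_, hy⟩
      rintro ⟨x, hx⟩
      exact hz ⟨x, maps_mul.2 ⟨y, hx, hy⟩⟩
    · exact Or.inl hzβ
  refine (hβ.union ?_).subset h
  have h2 : {z | ∃ y ∈ α.ranᶜ, β.Maps y z} = ⋃ y ∈ α.ranᶜ, {z | β.Maps y z} := by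
    ext x; simp
  rw [h2]
  exact hα.biUnion fun y _ => Set.Subsingleton.finite fun a ha b hb => Maps.right_unique ha hb

end SymInvMonoid

/-- The monoid of injective partial monotone selfmaps of a poset `X`
with cofinite domains and images. -/
def POInf (X : Type*) [PartialOrder X] : Submonoid (SymInvMonoid X) where
  carrier := {α | α.IsMonotone ∧ α.domᶜ.Finite ∧ α.ranᶜ.Finite}
  one_mem' := by
    refine ⟨fun x y x' y' hx hy h => ?_, ?_, ?_⟩
    · rwa [← SymInvMonoid.maps_one.1 hx, ← SymInvMonoid.maps_one.1 hy]
    · refine Set.finite_empty.subset fun x hx => hx ⟨x, SymInvMonoid.maps_one.2 rfl⟩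
    · refine Set.finite_empty.subset fun x hx => hx ⟨x, SymInvMonoid.maps_one.2 rfl⟩
  mul_mem' := by
    rintro α β ⟨mα, dα, rα⟩ ⟨mβ, dβ, rβ⟩
    refine ⟨fun x y x' y' hx hy h => ?_, SymInvMonoid.finite_compl_dom_mul dα dβ,
      SymInvMonoid.finite_compl_ran_mul rα rβ⟩
    obtain ⟨u, hu, hu'⟩ := SymInvMonoid.maps_mul.1 hx
    obtain ⟨v, hv, hv'⟩ := SymInvMonoid.maps_mul.1 hy
    exact mβ hu' hv' (mα hu hv h)

/-- The horizontal line `Hⁿ = {(j, n) : j ∈ ℕ}` in the square of the positive integers. -/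
def horizontalLine (n : ℕ+) : Set (ℕ+ × ℕ+) := {p | p.2 = n}

/-- The monoid of orientation-preserving monotone injective partial selfmaps of the square of
the positive integers (with the product order) with cofinite domains and images: those `α` that
map the part of `H¹` lying in the domain of `α` into `H¹`. -/
def POInfPlus : Submonoid (SymInvMonoid (ℕ+ × ℕ+)) where
  carrier := {α | α ∈ POInf (ℕ+ × ℕ+) ∧
    ∀ ⦃x y⦄, x ∈ horizontalLine 1 → α.Maps x y → y ∈ horizontalLine 1}
  one_mem' := by
    refine ⟨(POInf _).one_mem, fun x y hx hxy => ?_⟩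
    rwa [← SymInvMonoid.maps_one.1 hxy]
  mul_mem' := by
    rintro α β ⟨hα, lα⟩ ⟨hβ, lβ⟩
    refine ⟨(POInf _).mul_mem hα hβ, fun x z hx hxz => ?_⟩
    obtain ⟨y, hy, hz⟩ := SymInvMonoid.maps_mul.1 hxz
    exact lβ (lα hx hy) hz

/-! Preserving the first row rigidifies a map `α`: it also preserves the first column, and hence
raises neither coordinate (`maps_le`). Since `α` injects the part of its domain below a point into
the set below the image, far to the right it can neither leave a row nor do anything but translate
that row left by a fixed length (`exists_isShift`). These lengths add under composition, do not
increase with the row, and vanish in high rows. Their successive differences therefore give a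
homomorphism to finitely supported sequences of naturals under addition. The maps `leftShift k` hit
the basis vectors, so any sequence in `M` is realised as their values; an enumeration of `M` gives
surjectivity. -/

section Relation

/-! ### Rigidity of the first row and column -/

variable {R : ℕ+ × ℕ+ → ℕ+ × ℕ+ → Prop}

/-- If a monotone injective partial selfmap of the square with cofinite image preserves the first
row, then it preserves the first column. -/
theorem fst_eq_one_of_snd_preserved
    (inj : ∀ ⦃p p' q⦄, R p q → R p' q → p = p')
    (mono : ∀ ⦃p p' q q'⦄, R p q → R p' q' → p ≤ p' → q ≤ q')
    (hdom : {p | ∃ q, R p q}ᶜ.Finite) (hran : {q | ∃ p, R p q}ᶜ.Finite)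
    (hrow : ∀ ⦃p q⦄, R p q → p.2 = 1 → q.2 = 1)
    ⦃p q : ℕ+ × ℕ+⦄ (hpq : R p q) (hp : p.1 = 1) : q.1 = 1 := by
  -- columns in which the preimage of the first column may lie
  have hA : {a : ℕ+ | (a, 1) ∈ {p | ∃ q, R p q}ᶜ ∨ R (a, 1) (1, 1)}.Finite := by
    refine Set.Finite.union (hdom.preimage fun a _ b _ h => (Prod.ext_iff.1 h).1) ?_
    exact Set.Subsingleton.finite fun a ha b hb => (Prod.ext_iff.1 (inj ha hb)).1
  by_contra hq
  -- Preimages of the first column lie in a finite box: a point above `p` would map above `q`, off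
  -- that column, and a point `(a, b)` forces `(a, 1)`, if in the domain, onto `(1, 1)`.
  have hT : {r : ℕ+ × ℕ+ | ∃ s, R r s ∧ s.1 = 1}.Finite := by
    refine (hA.prod (Set.finite_Iio p.2)).subset ?_
    rintro ⟨a, b⟩ ⟨s, hs, hs1⟩
    refine ⟨?_, ?_⟩
    · by_cases h : (a, 1) ∈ {p | ∃ q, R p q}
      · obtain ⟨⟨u, v⟩, ht⟩ := h
        have h1 := mono ht hs ⟨le_rfl, one_le⟩
        have h2 : v = 1 := hrow ht rfl
        have h3 : u = 1 := le_antisymm (hs1 ▸ h1.1) one_le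
        subst h2 h3
        exact Or.inr ht
      · exact Or.inl h
    · by_contra hb
      have h1 := mono hpq hs ⟨hp.trans_le one_le, not_lt.1 hb⟩
      exact hq (le_antisymm (hs1 ▸ h1.1) one_le)
  have hC : {s : ℕ+ × ℕ+ | s.1 = 1}.Finite := by
    have himg : {s : ℕ+ × ℕ+ | ∃ r ∈ {r : ℕ+ × ℕ+ | ∃ s, R r s ∧ s.1 = 1}, R r s}.Finite := by
      have : {s : ℕ+ × ℕ+ | ∃ r ∈ {r : ℕ+ × ℕ+ | ∃ s, R r s ∧ s.1 = 1}, R r s} =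
          ⋃ r ∈ {r : ℕ+ × ℕ+ | ∃ s, R r s ∧ s.1 = 1}, {s | R r s} := by
        ext; simp
      rw [this]
      exact hT.biUnion fun r _ => Set.Subsingleton.finite fun s hs t ht =>
        le_antisymm (mono hs ht le_rfl) (mono ht hs le_rfl)
    refine (himg.union hran).subset fun s hs => ?_
    by_cases h : s ∈ {q | ∃ p, R p q}
    · obtain ⟨r, hr⟩ := h
      exact Or.inl ⟨r, ⟨s, hr, hs⟩, hr⟩
    · exact Or.inr h
  have hinf : (Set.univ : Set ℕ+).Finite :=
    (hC.preimage (f := fun n : ℕ+ => ((1 : ℕ+), n)) fun a _ b _ h => (Prod.ext_iff.1 h).2).subset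
      fun n _ => rfl
  exact Set.infinite_univ hinf

/-- If a monotone injective partial selfmap of the square with cofinite domain and image preserves
the first column, then it does not increase second coordinates. -/
theorem snd_le_snd_of_fst_preserved
    (inj : ∀ ⦃p p' q⦄, R p q → R p' q → p = p')
    (mono : ∀ ⦃p p' q q'⦄, R p q → R p' q' → p ≤ p' → q ≤ q')
    (hdom : {p | ∃ q, R p q}ᶜ.Finite) (hran : {q | ∃ p, R p q}ᶜ.Finite)
    (hcol : ∀ ⦃p q⦄, R p q → p.1 = 1 → q.1 = 1)
    ⦃p q : ℕ+ × ℕ+⦄ (hpq : R p q) : q.2 ≤ p.2 := by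
  have inj2 : ∀ ⦃p q q'⦄, R p q → R p q' → q = q' := fun p q q' h h' =>
    le_antisymm (mono h h' le_rfl) (mono h' h le_rfl)
  by_contra hlt
  have hB : {b : ℕ+ | (1, b) ∈ {p | ∃ q, R p q}ᶜ ∨ ∃ v ∈ Set.Iic p.2, R (1, b) (1, v)}.Finite := by
    refine Set.Finite.union (hdom.preimage fun a _ b _ h => (Prod.ext_iff.1 h).2) ?_
    refine ((Set.finite_Iic p.2).biUnion (t := fun v => {b : ℕ+ | R (1, b) (1, v)}) fun v _ =>
      Set.Subsingleton.finite fun a ha b hb => (Prod.ext_iff.1 (inj ha hb)).2).subset ?_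
    rintro b ⟨v, hv, hb⟩
    exact Set.mem_biUnion hv hb
  -- the preimage of the first `p.2` rows lies in finitely many rows
  have hrows : ∀ ⦃r s⦄, R r s → s.2 ≤ p.2 →
      r.2 ∈ {b : ℕ+ | (1, b) ∈ {p | ∃ q, R p q}ᶜ ∨ ∃ v ∈ Set.Iic p.2, R (1, b) (1, v)} := by
    rintro ⟨a, b⟩ s hs hs2
    by_cases h : (1, b) ∈ {p | ∃ q, R p q}
    · obtain ⟨⟨u, v⟩, ht⟩ := h
      have h1 := mono ht hs ⟨one_le, le_rfl⟩
      have h2 : u = 1 := hcol ht rfl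
      subst h2
      exact Or.inr ⟨v, h1.2.trans hs2, ht⟩
    · exact Or.inl h
  have hE : ({s : ℕ+ × ℕ+ | ∃ r, R r s ∧ s.2 ≤ p.2 ∧ r.1 < p.1} ∪
      {q | ∃ p, R p q}ᶜ).Finite := by
    refine Set.Finite.union ?_ hran
    have : {s : ℕ+ × ℕ+ | ∃ r, R r s ∧ s.2 ≤ p.2 ∧ r.1 < p.1} ⊆
        ⋃ r ∈ Set.Iio p.1 ×ˢ
          {b : ℕ+ | (1, b) ∈ {p | ∃ q, R p q}ᶜ ∨ ∃ v ∈ Set.Iic p.2, R (1, b) (1, v)},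
          {s | R r s} := by
      rintro s ⟨r, hr, hs, hrp⟩
      exact Set.mem_biUnion (Set.mem_prod.2 ⟨hrp, hrows hr hs⟩) hr
    exact (((Set.finite_Iio p.1).prod hB).biUnion fun r _ =>
      Set.Subsingleton.finite (s := {s | R r s}) fun s hs t ht => inj2 hs ht).subset this
  obtain ⟨N, hN⟩ := (hE.image Prod.fst).bddAbove
  -- an antichain of size `p.2` far to the right in the first `p.2` rows
  have hpre : ∀ i : Finset.Icc 1 p.2, ∃ r : ℕ+ × ℕ+,
      R r (N + 1 + p.2 - i, i) ∧ r.2 ∈ Finset.Iio p.2 := by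
    rintro ⟨i, hi⟩
    have hi' := Finset.mem_Icc.1 hi
    have hnot : (N + 1 + p.2 - i, i) ∉ ({s : ℕ+ × ℕ+ | ∃ r, R r s ∧ s.2 ≤ p.2 ∧ r.1 < p.1} ∪
        {q | ∃ p, R p q}ᶜ) := by
      intro h
      have h1 := hN (Set.mem_image_of_mem _ h)
      -- Subtraction in `ℕ+` defaults to `1` without this inequality.
      have h2 : i < N + 1 + p.2 := lt_of_le_of_lt hi'.2 (PNat.lt_add_left _ _)
      have h3 := PNat.sub_coe (N + 1 + p.2) i
      rw [if_pos h2] at h3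
      simp only [← PNat.coe_le_coe, h3, PNat.add_coe, PNat.one_coe] at h1
      have := PNat.coe_le_coe _ _ |>.2 hi'.2
      omega
    simp only [Set.mem_union, Set.mem_compl_iff, not_or, not_not] at hnot
    obtain ⟨h1, r, hr⟩ := hnot
    refine ⟨r, hr, ?_⟩
    have hr1 : p.1 ≤ r.1 := by
      by_contra h
      exact h1 ⟨r, hr, hi'.2, not_le.1 h⟩
    rw [Finset.mem_Iio]
    by_contra h
    exact hlt ((mono hpq hr ⟨hr1, not_lt.1 h⟩).2.trans hi'.2)
  choose r hr hr2 using hpre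
  -- Pigeonhole: the `p.2` preimages occupy fewer than `p.2` rows, so two share a row and are
  -- comparable, while their images are not.
  have hcard : (Finset.Iio p.2).card < (Finset.Icc 1 p.2).attach.card := by
    rw [Finset.card_attach]
    refine Finset.card_lt_card ⟨fun x hx => ?_, fun h => ?_⟩
    · exact Finset.mem_Icc.2 ⟨one_le, (Finset.mem_Iio.1 hx).le⟩
    · exact lt_irrefl _ (Finset.mem_Iio.1 (h (Finset.mem_Icc.2 ⟨one_le, le_rfl⟩)))
  obtain ⟨i, -, j, -, hij, heq⟩ := Finset.exists_ne_map_eq_of_card_lt_of_maps_to hcard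
    (f := fun i => (r i).2) fun i _ => hr2 i
  have key : ∀ i j : Finset.Icc 1 p.2, (r i).2 = (r j).2 → (r i).1 ≤ (r j).1 → i = j := by
    rintro ⟨i, hi⟩ ⟨j, hj⟩ h2 h1
    have h := mono (hr ⟨i, hi⟩) (hr ⟨j, hj⟩) ⟨h1, h2.le⟩
    have hi' := (Finset.mem_Icc.1 hi).2
    have hj' := (Finset.mem_Icc.1 hj).2
    have h3 := PNat.sub_coe (N + 1 + p.2) i
    have h4 := PNat.sub_coe (N + 1 + p.2) j
    rw [if_pos (lt_of_le_of_lt hi' (PNat.lt_add_left _ _))] at h3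
    rw [if_pos (lt_of_le_of_lt hj' (PNat.lt_add_left _ _))] at h4
    have h5 := h.1
    have h6 := h.2
    simp only [← PNat.coe_le_coe, h3, h4, PNat.add_coe, PNat.one_coe] at h5 h6 hi' hj'
    have h7 : i = j := PNat.coe_injective (by omega)
    exact Subtype.ext h7
  rcases le_total (r i).1 (r j).1 with h | h
  · exact hij (key i j heq h)
  · exact hij (key j i heq.symm h).symm

end Relation

namespace POInfPlus

open SymInvMonoid

variable {α β : SymInvMonoid (ℕ+ × ℕ+)}

/-- The first coordinate is handled by conjugating with `Prod.swap`, which turns the row hypothesis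
into the column hypothesis. -/
theorem maps_le (hα : α ∈ POInfPlus) {p q : ℕ+ × ℕ+} (h : α.Maps p q) : q ≤ p := by
  obtain ⟨⟨mono, hd, hr⟩, hrow⟩ := hα
  have inj : ∀ ⦃p p' q⦄, α.Maps p q → α.Maps p' q → p = p' := fun _ _ _ h h' => h.left_inj h'
  have hswap : Function.Injective (Prod.swap : ℕ+ × ℕ+ → ℕ+ × ℕ+) := Prod.swap_injective
  refine ⟨?_, snd_le_snd_of_fst_preserved inj (fun _ _ _ _ h h' => mono h h') hd hr
    (fst_eq_one_of_snd_preserved inj (fun _ _ _ _ h h' => mono h h') hd hr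
      fun p q h hp => hrow hp h) h⟩
  refine snd_le_snd_of_fst_preserved (R := fun p q => α.Maps p.swap q.swap)
    (p := p.swap) (q := q.swap) (fun _ _ _ h h' => hswap (h.left_inj h'))
    (fun _ _ _ _ h h' hle => Prod.swap_le_swap.1 (mono h h' (Prod.swap_le_swap.2 hle)))
    ((hd.preimage hswap.injOn).subset ?_) ((hr.preimage hswap.injOn).subset ?_)
    (fun p q h hp => hrow hp h) h
  · rintro x hx ⟨y, hy⟩
    exact hx ⟨y.swap, by simpa using hy⟩
  · rintro x hx ⟨y, hy⟩
    exact hx ⟨y.swap, by simpa using hy⟩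

theorem mul_le_ncard_add_mul (hα : α ∈ POInfPlus) {p q : ℕ+ × ℕ+} (h : α.Maps p q) :
    (p.1 * p.2 : ℕ) ≤ α.domᶜ.ncard + q.1 * q.2 := by
  obtain ⟨⟨mono, hd, -⟩, -⟩ := hα
  have card : ∀ p : ℕ+ × ℕ+, (Set.Iic p).ncard = (p.1 * p.2 : ℕ) := by
    intro p
    have : Set.Iic p = ((Finset.Icc 1 p.1 ×ˢ Finset.Icc 1 p.2 : Finset (ℕ+ × ℕ+)) : Set _) := by
      ext x; simp [Prod.le_def]
    rw [this, Set.ncard_coe_finset, Finset.card_product]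
    simp
  have hsub : Set.Iic p \ α.domᶜ ⊆ {x | ∃ y ∈ Set.Iic q, α.Maps x y} := by
    rintro x ⟨hx, hxd⟩
    obtain ⟨y, hy⟩ := not_not.1 hxd
    exact ⟨y, mono hy h hx, hy⟩
  have hle : (Set.Iic p \ α.domᶜ).ncard ≤ (Set.Iic q).ncard := by
    choose! g hg hgm using hsub
    exact Set.ncard_le_ncard_of_injOn g hg
      (fun a ha b hb hab => (hgm ha).left_inj (hab ▸ hgm hb)) (Set.finite_Iic q)
  have h1 := Set.ncard_le_ncard_sdiff_add_ncard (Set.Iic p) α.domᶜ hd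
  rw [card] at h1 hle
  omega

/-! ### Eventual translation lengths of rows -/

/-- `α` eventually translates the `j`-th row by `d` to the left. -/
def IsShift (α : SymInvMonoid (ℕ+ × ℕ+)) (j : ℕ+) (d : ℕ) : Prop :=
  ∃ N : ℕ, ∀ x : ℕ+, N ≤ x → ∃ y : ℕ+, α.Maps (x, j) (y, j) ∧ (x : ℕ) = y + d

theorem IsShift.unique {j : ℕ+} {d e : ℕ} (hd : IsShift α j d) (he : IsShift α j e) : d = e := by
  obtain ⟨N, hN⟩ := hd
  obtain ⟨N', hN'⟩ := he
  obtain ⟨y, hy, h⟩ := hN ⟨N + N' + 1, by omega⟩ (by simp; omega)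
  obtain ⟨y', hy', h'⟩ := hN' ⟨N + N' + 1, by omega⟩ (by simp; omega)
  have := (Prod.ext_iff.1 (hy.right_unique hy')).1
  simp only at this
  subst this
  omega

theorem IsShift.mul {j : ℕ+} {d e : ℕ} (hd : IsShift α j d) (he : IsShift β j e) :
    IsShift (α * β) j (d + e) := by
  obtain ⟨N, hN⟩ := hd
  obtain ⟨N', hN'⟩ := he
  refine ⟨N + N' + d, fun x hx => ?_⟩
  obtain ⟨y, hy, h⟩ := hN x (by omega)
  obtain ⟨z, hz, h'⟩ := hN' y (by omega)
  exact ⟨z, maps_mul.2 ⟨_, hy, hz⟩, by omega⟩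

theorem IsShift.one (j : ℕ+) : IsShift 1 j 0 :=
  ⟨0, fun x _ => ⟨x, maps_one.2 rfl, rfl⟩⟩

theorem IsShift.antitone (hα : α ∈ POInfPlus) {i j : ℕ+} (hij : i ≤ j) {d e : ℕ}
    (hd : IsShift α i d) (he : IsShift α j e) : e ≤ d := by
  obtain ⟨N, hN⟩ := hd
  obtain ⟨N', hN'⟩ := he
  obtain ⟨y, hy, h⟩ := hN ⟨N + N' + 1, by omega⟩ (by simp; omega)
  obtain ⟨y', hy', h'⟩ := hN' ⟨N + N' + 1, by omega⟩ (by simp; omega)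
  have := PNat.coe_le_coe _ _ |>.2 (hα.1.1 hy hy' ⟨le_rfl, hij⟩).1
  simp only at this
  omega

theorem exists_isShift (hα : α ∈ POInfPlus) (j : ℕ+) : ∃ d, IsShift α j d := by
  have hdom : ∃ N : ℕ, ∀ x : ℕ+, N ≤ x → (x, j) ∈ α.dom := by
    obtain ⟨N, hN⟩ := (hα.1.2.1.image fun p => (p.1 : ℕ)).bddAbove
    refine ⟨N + 1, fun x hx => ?_⟩
    by_contra h
    have := hN ⟨_, h, rfl⟩
    simp only at this
    omega
  obtain ⟨N, hN⟩ := hdom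
  -- Dropping to a lower row would lose at least `x` points from the rectangle below, more than the
  -- domain misses.
  have hrow : ∀ x : ℕ+, N + α.domᶜ.ncard + 1 ≤ x →
      ∃ d, ∃ y : ℕ+, α.Maps (x, j) (y, j) ∧ (x : ℕ) = y + d := by
    intro x hx
    obtain ⟨⟨y, i⟩, h⟩ := hN x (by omega)
    have h1 := maps_le hα h
    have hy : (y : ℕ) ≤ x := h1.1
    have hi : (i : ℕ) ≤ j := h1.2
    have h2 := mul_le_ncard_add_mul hα h
    simp only at h2
    have hij : i = j := by
      refine PNat.coe_injective (le_antisymm hi ?_)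
      by_contra hlt
      have h3 : (i : ℕ) + 1 ≤ j := by omega
      have h4 : (x : ℕ) * (i + 1) ≤ x * j := Nat.mul_le_mul_left _ h3
      have h5 : (y : ℕ) * i ≤ x * i := Nat.mul_le_mul_right _ hy
      rw [mul_add, mul_one] at h4
      omega
    subst hij
    exact ⟨x - y, y, h, by omega⟩
  classical
  have hex : ∃ d, ∃ x : ℕ+, N + α.domᶜ.ncard + 1 ≤ x ∧
      ∃ y : ℕ+, α.Maps (x, j) (y, j) ∧ (x : ℕ) = y + d := by
    obtain ⟨d, h⟩ := hrow ⟨N + α.domᶜ.ncard + 1, by omega⟩ le_rfl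
    exact ⟨d, _, le_rfl, h⟩
  -- Images strictly increase along the row, so the displacement never grows; once minimal, it stays
  -- constant.
  obtain ⟨x₀, hx₀, y₀, h₀, h₀'⟩ := Nat.find_spec hex
  refine ⟨Nat.find hex, x₀, fun x hx => ?_⟩
  induction hn : (x : ℕ) - x₀ generalizing x with
  | zero =>
    have : x = x₀ := PNat.coe_injective (by omega)
    exact ⟨y₀, this ▸ h₀, this ▸ h₀'⟩
  | succ n ih =>
    obtain ⟨d, y, hy, hd⟩ := hrow x (by omega)
    have hmin := Nat.find_min' hex ⟨x, by omega, y, hy, hd⟩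
    have hx1 : 0 < (x : ℕ) - 1 := by omega
    obtain ⟨z, hz, hz'⟩ := ih ⟨(x : ℕ) - 1, hx1⟩ (by simp; omega) (by simp; omega)
    have hlt : z < y := by
      have hle := (hα.1.1 hz hy ⟨by rw [← PNat.coe_le_coe]; simp, le_rfl⟩).1
      refine lt_of_le_of_ne hle fun h => ?_
      have := congrArg PNat.val (Prod.ext_iff.1 (hz.left_inj (h ▸ hy))).1
      simp only [PNat.mk_coe] at this
      omega
    have hlt' := PNat.coe_lt_coe _ _ |>.2 hlt
    simp only [PNat.mk_coe] at hz'
    exact ⟨y, hy, by omega⟩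

/-- The number of steps by which `α` eventually translates the `j`-th row to the left. -/
noncomputable def shift (α : POInfPlus) (j : ℕ+) : ℕ :=
  (exists_isShift α.2 j).choose

theorem isShift_shift (α : POInfPlus) (j : ℕ+) : IsShift α j (shift α j) :=
  (exists_isShift α.2 j).choose_spec

theorem shift_eq {α : POInfPlus} {j : ℕ+} {d : ℕ} (h : IsShift (α : SymInvMonoid _) j d) :
    shift α j = d :=
  (isShift_shift α j).unique h

theorem shift_mul (α β : POInfPlus) (j : ℕ+) : shift (α * β) j = shift α j + shift β j :=
  shift_eq ((isShift_shift α j).mul (isShift_shift β j))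

theorem shift_one (j : ℕ+) : shift 1 j = 0 :=
  shift_eq (IsShift.one j)

theorem shift_succ_le (α : POInfPlus) (j : ℕ+) : shift α (j + 1) ≤ shift α j :=
  IsShift.antitone α.2 (PNat.lt_add_right j 1).le (isShift_shift α j) (isShift_shift α (j + 1))

/-- A translation by `d` in row `j` shrinks the rectangle below by `d * j` points, which cannot
exceed the size of the missing domain. -/
theorem shift_eq_zero (α : POInfPlus) {j : ℕ+}
    (hj : (α : SymInvMonoid (ℕ+ × ℕ+)).domᶜ.ncard < j) : shift α j = 0 := by
  obtain ⟨N, hN⟩ := isShift_shift α j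
  obtain ⟨y, hy, h⟩ := hN ⟨N + 1, by omega⟩ (by simp)
  have h1 := mul_le_ncard_add_mul α.2 hy
  simp only [h, add_mul] at h1
  by_contra h0
  have : (j : ℕ) ≤ shift α j * j := Nat.le_mul_of_pos_left _ (by omega)
  omega

/-! ### The homomorphism given by jumps -/

/-- The jump of the translation lengths between the rows `j` and `j + 1`. -/
noncomputable def jump (α : POInfPlus) (j : ℕ+) : ℕ := shift α j - shift α (j + 1)

theorem jump_one (j : ℕ+) : jump 1 j = 0 := by
  simp [jump, shift_one]

/-- Monotonicity of `shift` in the row keeps the natural subtraction from truncating. -/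
theorem jump_mul (α β : POInfPlus) (j : ℕ+) : jump (α * β) j = jump α j + jump β j := by
  have h1 := shift_succ_le α j
  have h2 := shift_succ_le β j
  simp only [jump, shift_mul]
  omega

theorem finite_mulSupport_pow_jump {M : Type*} [CommMonoid M] (m : ℕ+ → M) (α : POInfPlus) :
    (Function.mulSupport fun j => m j ^ jump α j).Finite := by
  refine (((Set.finite_Iic (α : SymInvMonoid (ℕ+ × ℕ+)).domᶜ.ncard).preimage
    PNat.coe_injective.injOn)).subset fun j hj => ?_
  by_contra h
  refine hj ?_
  have h0 : jump α j = 0 := by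
    rw [jump, shift_eq_zero α (not_le.1 h), Nat.zero_sub]
  simp [h0]

/-- The homomorphism that evaluates the jumps of a partial map at a sequence of elements of a
commutative monoid. -/
noncomputable def evalJump {M : Type*} [CommMonoid M] (m : ℕ+ → M) : POInfPlus →* M where
  toFun α := ∏ᶠ j, m j ^ jump α j
  map_one' := by simp [jump_one]
  map_mul' α β := by
    rw [← finprod_mul_distrib (finite_mulSupport_pow_jump m α) (finite_mulSupport_pow_jump m β)]
    simp only [jump_mul, pow_add]

/-! ### Maps realising the basis vectors -/

/-- The partial map that moves the first `k` rows by one step to the left. -/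
def leftShift (k : ℕ+) : SymInvMonoid (ℕ+ × ℕ+) :=
  (show PEquiv (ℕ+ × ℕ+) (ℕ+ × ℕ+) from
  { toFun := fun p => if p.2 ≤ k then (if p.1 = 1 then none else some (p.1 - 1, p.2)) else some p
    invFun := fun p => if p.2 ≤ k then some (p.1 + 1, p.2) else some p
    inv := by
      rintro ⟨a, b⟩ ⟨c, d⟩
      by_cases hb : b ≤ k <;> by_cases hd : d ≤ k
      · by_cases ha : a = 1
        · have h1 : c + 1 ≠ 1 := (PNat.lt_add_left 1 c).ne'
          simp [hb, hd, ha, h1]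
        · have h1 : 1 < a := lt_of_le_of_ne one_le (Ne.symm ha)
          have h2 := PNat.sub_coe a 1
          rw [if_pos h1] at h2
          have h3 : (1 : ℕ) < a := h1
          simp only [hb, hd, ha, if_true, if_false, Option.some_inj,
            Prod.mk.injEq, ← PNat.coe_inj, h2, PNat.add_coe, PNat.one_coe]
          omega
      · have : b ≠ d := by rintro rfl; exact hd hb
        by_cases ha : a = 1 <;> simp [hb, hd, ha, this, this.symm]
      · have : b ≠ d := by rintro rfl; exact hb hd
        simp [hb, hd, this, this.symm]
      · simp [hb, hd, eq_comm] })

theorem leftShift_maps {k : ℕ+} {p q : ℕ+ × ℕ+} :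
    (leftShift k).Maps p q ↔ p.2 = q.2 ∧ (p.1 : ℕ) = q.1 + if p.2 ≤ k then 1 else 0 := by
  obtain ⟨a, b⟩ := p
  obtain ⟨c, d⟩ := q
  have h : (leftShift k).Maps (a, b) (c, d) ↔
      (if d ≤ k then some (c + 1, d) else some (c, d)) = some (a, b) :=
    (PEquiv.eq_some_iff _).symm
  rw [h]
  simp only
  by_cases hd : d ≤ k
  · rw [if_pos hd]
    simp only [Option.some_inj, Prod.mk.injEq, ← PNat.coe_inj, PNat.add_coe, PNat.one_coe]
    constructor
    · rintro ⟨h1, h2⟩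
      have := PNat.coe_injective h2
      subst this
      simp [hd, h1]
    · rintro ⟨h1, h2⟩
      have := PNat.coe_injective h1
      subst this
      simp [hd, h2]
  · rw [if_neg hd]
    simp only [Option.some_inj, Prod.mk.injEq, ← PNat.coe_inj]
    constructor
    · rintro ⟨h1, h2⟩
      have := PNat.coe_injective h2
      subst this
      simp [hd, h1]
    · rintro ⟨h1, h2⟩
      have := PNat.coe_injective h1
      subst this
      simp [hd, h2]

theorem leftShift_mem (k : ℕ+) : leftShift k ∈ POInfPlus := by
  refine ⟨⟨?_, ?_, ?_⟩, ?_⟩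
  · intro p q p' q' hp hq hle
    rw [leftShift_maps] at hp hq
    have h1 : (p.1 : ℕ) ≤ q.1 := hle.1
    refine ⟨?_, hp.1 ▸ hq.1 ▸ hle.2⟩
    rw [← PNat.coe_le_coe]
    -- The moved rows form a down-set, so the larger point moves only if the smaller does.
    have h2 : q.2 ≤ k → p.2 ≤ k := hle.2.trans
    by_cases hqk : q.2 ≤ k
    · simp only [hqk, h2 hqk, if_true] at hp hq
      omega
    · simp only [hqk, if_false] at hq
      omega
  · refine ((Set.finite_Iic (1 : ℕ+)).prod (Set.finite_Iic k)).subset fun p hp => ?_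
    by_contra hmem
    refine hp ?_
    rw [Set.mem_prod, not_and_or] at hmem
    simp only [Set.mem_Iic, not_le] at hmem
    by_cases hk : p.2 ≤ k
    · have h1 : (1 : ℕ+) < p.1 := hmem.resolve_right (not_lt.2 hk)
      have h2 : (1 : ℕ) < p.1 := h1
      exact ⟨(⟨p.1 - 1, by omega⟩, p.2), leftShift_maps.2 ⟨rfl, by simp [hk]; omega⟩⟩
    · exact ⟨p, leftShift_maps.2 ⟨rfl, by simp [hk]⟩⟩
  · refine Set.finite_empty.subset fun q hq => hq ?_
    refine ⟨(⟨q.1 + if q.2 ≤ k then 1 else 0, by positivity⟩, q.2), leftShift_maps.2 ⟨rfl, rfl⟩⟩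
  · intro p q hp h
    exact (leftShift_maps.1 h).1.symm.trans hp

theorem shift_leftShift (k j : ℕ+) :
    shift ⟨leftShift k, leftShift_mem k⟩ j = if j ≤ k then 1 else 0 := by
  -- Column `1` is outside the domain in the moved rows, hence the threshold `2`.
  refine shift_eq ⟨2, fun x hx => ?_⟩
  refine ⟨⟨x - if j ≤ k then 1 else 0, by split_ifs <;> omega⟩, ?_, ?_⟩
  · refine leftShift_maps.2 ⟨rfl, ?_⟩
    simp only [PNat.mk_coe]
    split_ifs <;> omega
  · simp only [PNat.mk_coe]
    split_ifs <;> omega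

theorem jump_leftShift (k j : ℕ+) :
    jump ⟨leftShift k, leftShift_mem k⟩ j = if j = k then 1 else 0 := by
  simp only [jump, shift_leftShift, ← PNat.coe_le_coe, ← PNat.coe_inj, PNat.add_coe, PNat.one_coe]
  split_ifs <;> omega

theorem evalJump_leftShift {M : Type*} [CommMonoid M] (m : ℕ+ → M) (k : ℕ+) :
    evalJump m ⟨leftShift k, leftShift_mem k⟩ = m k := by
  change ∏ᶠ j, m j ^ jump ⟨leftShift k, leftShift_mem k⟩ j = m k
  rw [finprod_eq_single _ k fun j hj => by simp [jump_leftShift, hj]]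
  simp [jump_leftShift]

end POInfPlus

/-- Every countable (finite or infinite) commutative monoid is a homomorphic image of the monoid
of orientation-preserving monotone injective partial selfmaps of the square of the positive
integers with cofinite domains and images. -/
theorem corollary2p16 (M : Type*) [CommMonoid M] [Countable M] :
    ∃ f : POInfPlus →* M, Function.Surjective f := by
  obtain ⟨g, hg⟩ := exists_surjective_nat M
  refine ⟨POInfPlus.evalJump fun j => g j.natPred, fun x => ?_⟩
  obtain ⟨n, rfl⟩ := hg x
  exact ⟨_, (POInfPlus.evalJump_leftShift _ n.succPNat).trans (by simp)⟩
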